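/- Let $M$ be a metric space that is * complete; * $\omega$-homogeneous: every isometry $f\colon A\to B$ between finite subsets $A,B\subseteq M$ extends to an isometry of $M$ onto itself; * Urysohn: the diameter of $M$ is equal to $1$ and, whenever $L$ is a finite metric space of diameter $\le 1$, $K\subseteq L$ and $f\colon K\to M$ is an isometric embedding, $f$ extends to an isometric embedding $L\to M$. Let $\mathrm{Iso}(M)$ be the topological group of all isometries of $M$ onto itself, with the topology of pointwise convergence. Then: 1. $\mathrm{Iso}(M)$ is Rajkov-complete, that is, complete with respect to its upper uniformity $\mathcal L\vee\mathcal R$, the least upper bound of the left uniformity $\mathcal L$ and the right uniformity $\mathcal R$; 2. $\mathrm{Iso}(M)$ is Roelcke-precompact, that is, precompact (totally bounded) with respect to its Roelcke uniformity $\mathcal L\wedge\mathcal R$, the greatest lower bound of $\mathcal L$ and $\mathcal R$; 3. $\mathrm{Iso}(M)$ is minimal, that is, it is a Hausdorff topological group that admits no strictly coarser Hausdorff group topology; 4. $\mathrm{Iso}(M)$ is topologically simple, that is, it has no closed normal subgroups other than $\mathrm{Iso}(M)$ and the trivial subgroup; 5. $w(\mathrm{Iso}(M))=w(M)$, where the weight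 $w(X)$ of a topological space $X$ is the least cardinality of a base of its topology. -/

import Mathlib

universe u

namespace UrysohnIso

section Metric

/-- A metric space `M` is `ω`-homogeneous if every isometry between finite subsets of `M`
extends to an isometry of `M` onto itself. -/
def OmegaHomogeneous (M : Type u) [MetricSpace M] : Prop :=
  ∀ (A B : Set M), A.Finite → B.Finite → ∀ f : A ≃ᵢ B,
    ∃ g : M ≃ᵢ M, ∀ x : A, g (x : M) = (f x : M)

/-- A metric space `M` is Urysohn if its diameter is equal to `1` and, for every finite metric
space `L` of diameter at most `1` and every `K ⊆ L`, each isometric embedding `K → M` extends to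
an isometric embedding `L → M`. A finite metric space has an isometric copy in every universe, so
taking `L` in the universe of `M` is no restriction. (`Metric.diam` of an unbounded space is `0`,
so the first condition forces `M` to be bounded.) -/
def IsUrysohn (M : Type u) [MetricSpace M] : Prop :=
  Metric.diam (Set.univ : Set M) = 1 ∧
    ∀ (L : Type u) [MetricSpace L] [Finite L], Metric.diam (Set.univ : Set L) ≤ 1 →
      ∀ (K : Set L) (f : K → M), Isometry f →
        ∃ g : L → M, Isometry g ∧ ∀ x : K, g (x : L) = f x

end Metric

section IsometryGroup

variable {M : Type u} [MetricSpace M]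

/-- The group `M ≃ᵢ M` of isometries of `M` onto itself carries the topology of pointwise
convergence, that is, the topology induced by the product topology on `M → M`. -/
instance isoTopology : TopologicalSpace (M ≃ᵢ M) :=
  TopologicalSpace.induced (fun (g : M ≃ᵢ M) (x : M) => g x) Pi.topologicalSpace

theorem continuous_eval (x : M) : Continuous fun g : M ≃ᵢ M => g x :=
  (continuous_apply x).comp continuous_induced_dom

/-- With the topology of pointwise convergence, `M ≃ᵢ M` is a topological group. -/
instance isoTopologicalGroup : IsTopologicalGroup (M ≃ᵢ M) where
  continuous_mul := by
    refine continuous_induced_rng.2 (continuous_pi fun x => ?_)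
    refine continuous_iff_continuousAt.2 fun p => ?_
    have h1 : Filter.Tendsto (fun q : (M ≃ᵢ M) × (M ≃ᵢ M) => dist (q.2 x) (p.2 x))
        (nhds p) (nhds 0) :=
      tendsto_iff_dist_tendsto_zero.1 (((continuous_eval x).comp continuous_snd).tendsto p)
    have h2 : Filter.Tendsto (fun q : (M ≃ᵢ M) × (M ≃ᵢ M) => dist (q.1 (p.2 x)) (p.1 (p.2 x)))
        (nhds p) (nhds 0) :=
      tendsto_iff_dist_tendsto_zero.1
        (((continuous_eval (p.2 x)).comp continuous_fst).tendsto p)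
    refine tendsto_iff_dist_tendsto_zero.2
      (squeeze_zero (fun _ => dist_nonneg) (fun q => ?_) (by simpa using h1.add h2))
    calc dist (q.1 (q.2 x)) (p.1 (p.2 x))
        ≤ dist (q.1 (q.2 x)) (q.1 (p.2 x)) + dist (q.1 (p.2 x)) (p.1 (p.2 x)) :=
          dist_triangle _ _ _
      _ = dist (q.2 x) (p.2 x) + dist (q.1 (p.2 x)) (p.1 (p.2 x)) := by rw [q.1.dist_eq]
  continuous_inv := by
    refine continuous_induced_rng.2 (continuous_pi fun x => ?_)
    refine continuous_iff_continuousAt.2 fun p => ?_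
    have h : Filter.Tendsto (fun q : M ≃ᵢ M => dist (q (p⁻¹ x)) (p (p⁻¹ x)))
        (nhds p) (nhds 0) :=
      tendsto_iff_dist_tendsto_zero.1 ((continuous_eval (p⁻¹ x)).tendsto p)
    refine tendsto_iff_dist_tendsto_zero.2
      (squeeze_zero (fun _ => dist_nonneg) (fun q => ?_) h)
    have e : dist (q⁻¹ x) (p⁻¹ x) = dist (q (p⁻¹ x)) (p (p⁻¹ x)) := by
      rw [← q.dist_eq (q⁻¹ x), IsometryEquiv.apply_inv_self, IsometryEquiv.apply_inv_self,
        dist_comm]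
    exact e.le

end IsometryGroup

section TopologicalGroup

/-- The upper uniformity of a topological group: the least upper bound of the left and the right
uniformities, i.e. the coarsest uniformity finer than both. In Mathlib's order on uniform
structures, finer means smaller, so this is an infimum. -/
abbrev upperUniformity (G : Type u) [Group G] [TopologicalSpace G] [IsTopologicalGroup G] :
    UniformSpace G :=
  IsTopologicalGroup.leftUniformSpace G ⊓ IsTopologicalGroup.rightUniformSpace G

/-- The Roelcke (lower) uniformity of a topological group: the greatest lower bound of the left
and the right uniformities, i.e. the finest uniformity coarser than both. In Mathlib's order on
uniform structures this is a supremum. -/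
abbrev roelckeUniformity (G : Type u) [Group G] [TopologicalSpace G] [IsTopologicalGroup G] :
    UniformSpace G :=
  IsTopologicalGroup.leftUniformSpace G ⊔ IsTopologicalGroup.rightUniformSpace G

/-- A topological group is Rajkov-complete if it is complete for its upper uniformity. -/
def RajkovComplete (G : Type u) [Group G] [TopologicalSpace G] [IsTopologicalGroup G] : Prop :=
  @CompleteSpace G (upperUniformity G)

/-- A topological group is Roelcke-precompact if it is precompact (totally bounded) for its
Roelcke uniformity. -/
def RoelckePrecompact (G : Type u) [Group G] [TopologicalSpace G] [IsTopologicalGroup G] : Prop :=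
  @TotallyBounded G (roelckeUniformity G) Set.univ

/-- A group with a topology `t` is a minimal topological group if it is a Hausdorff topological
group and every Hausdorff group topology coarser than `t` is equal to `t`.
(`t ≤ t'` means that `t'` is coarser than `t`.) -/
def MinimalTopologicalGroup (G : Type u) [Group G] [t : TopologicalSpace G] : Prop :=
  IsTopologicalGroup G ∧ T2Space G ∧
    ∀ t' : TopologicalSpace G, t ≤ t' → @IsTopologicalGroup G t' _ → @T2Space G t' → t' = t

/-- A topological group is topologically simple if it has no closed normal subgroups besides the
whole group and the trivial subgroup. -/
def TopologicallySimple (G : Type u) [Group G] [TopologicalSpace G] : Prop :=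
  ∀ N : Subgroup G, N.Normal → IsClosed (N : Set G) → N = ⊥ ∨ N = ⊤

end TopologicalGroup

/-- The weight of a topological space: the least cardinality of a base of its topology. -/
noncomputable def weight (X : Type u) [TopologicalSpace X] : Cardinal.{u} :=
  sInf {c : Cardinal.{u} |
    ∃ B : Set (Set X), TopologicalSpace.IsTopologicalBasis B ∧ Cardinal.mk B = c}

end UrysohnIso

/-! An isometry `g` is encoded by the function `(x, y) ↦ dist x (g y)`, which records how two copies
of `M` glued along `g` lie in relation to each other. The bi-Katetov functions, which describe all
gluings of two copies with distances at most `1`, form a compact subset of `ℝ^(M × M)`. By the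
Urysohn property and homogeneity each of them agrees with some isometry on any given finite set.
Isometries whose functions are close on a finite set are Roelcke-close (`exists_approx_conj`), so
compactness gives Roelcke-precompactness.

Minimality and simplicity come from one dichotomy. For the filter `F` of neighbourhoods of `1` in a
coarser group topology, Hausdorff or not, consider the cluster points of the encoding along `F`.
They form a compact set, invariant under swapping and conjugation, and closed under the composition
`bicomp` because free amalgams realize compositions approximately. Among those above the metric
there is a largest, `e`; it is conjugation invariant and idempotent, so either `e ≥ 1` everywhere or
`e` vanishes on the diagonal. In the first case `F = ⊤`. In the second, `f` composed with its swap
lies below `e`, so every row of every cluster point `f` has infimum `0`, and by swapping so does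
every column.

If the coarser topology is Hausdorff, completeness turns such an `f` into an isometry, which
separation forces to be `1`; hence `F` is the original filter. For a closed normal subgroup `N`, the
dichotomy is applied to the topology pulled back from the quotient: conjugates of a nontrivial
element of `N` have a cluster point with a column bounded away from `0`, so only `F = ⊤`, that is `N
= ⊤`, remains. -/

namespace UrysohnIso

/-! ### Extension and homogeneity for finite configurations -/

section Extension

variable {M : Type u} [MetricSpace M]

theorem IsUrysohn.dist_le_one (h : IsUrysohn M) (x y : M) : dist x y ≤ 1 := by
  have hb : Bornology.IsBounded (Set.univ : Set M) := by
    by_contra hb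
    have := Metric.diam_eq_zero_of_unbounded hb
    rw [h.1] at this
    exact one_ne_zero this
  exact (Metric.dist_le_diam_of_mem hb (Set.mem_univ x) (Set.mem_univ y)).trans h.1.le

theorem IsUrysohn.nonempty (h : IsUrysohn M) : Nonempty M := by
  by_contra hM
  rw [not_nonempty_iff] at hM
  have := h.1
  rw [Set.univ_eq_empty_iff.2 hM, Metric.diam_empty] at this
  exact zero_ne_one this

/-- The extension property of a Urysohn space, for finite pseudometric spaces. -/
theorem IsUrysohn.exists_extension (h : IsUrysohn M) {X : Type u} [PseudoMetricSpace X] [Finite X]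
    (hX : ∀ x y : X, dist x y ≤ 1) (K : Set X) (f : K → M) (hf : Isometry f) :
    ∃ g : X → M, Isometry g ∧ ∀ x : K, g x = f x := by
  let p : X → SeparationQuotient X := SeparationQuotient.mk
  have hp : Isometry p := Isometry.of_dist_eq fun _ _ => SeparationQuotient.dist_mk _ _
  let c : (p '' K) → K := fun z => ⟨z.2.choose, z.2.choose_spec.1⟩
  have hc : ∀ z, p (c z) = z := fun z => z.2.choose_spec.2
  have : Finite (SeparationQuotient X) := Finite.of_surjective p SeparationQuotient.surjective_mk
  obtain ⟨g, hg, hgf⟩ := h.2 (SeparationQuotient X)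
    (Metric.diam_le_of_forall_dist_le zero_le_one fun x _ y _ => by
      obtain ⟨x, rfl⟩ := SeparationQuotient.surjective_mk x
      obtain ⟨y, rfl⟩ := SeparationQuotient.surjective_mk y
      rw [SeparationQuotient.dist_mk]
      exact hX x y) (p '' K) (fun z => f (c z))
    (Isometry.of_dist_eq fun z w => by
      rw [hf.dist_eq, Subtype.dist_eq, ← hp.dist_eq, hc, hc, Subtype.dist_eq])
  refine ⟨g ∘ p, hg.comp hp, fun x => ?_⟩
  have hx := hgf ⟨p x, Set.mem_image_of_mem p x.2⟩
  refine hx.trans (dist_eq_zero.1 ?_)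
  rw [hf.dist_eq, Subtype.dist_eq, ← hp.dist_eq, hc, dist_self]

/-- Families may repeat points: equal distances force `a i = a j` exactly when `b i = b j`, so the
map between the ranges is well defined. -/
theorem OmegaHomogeneous.exists_isometryEquiv (h : OmegaHomogeneous M) {ι : Type*} [Finite ι]
    (a b : ι → M) (hab : ∀ i j, dist (a i) (a j) = dist (b i) (b j)) :
    ∃ g : M ≃ᵢ M, ∀ i, g (a i) = b i := by
  let c : Set.range a → ι := fun z => z.2.choose
  have hc : ∀ z, a (c z) = z := fun z => z.2.choose_spec
  let f : Set.range a → Set.range b := fun z => ⟨b (c z), Set.mem_range_self _⟩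
  have hf : Isometry f := Isometry.of_dist_eq fun z w => by
    rw [Subtype.dist_eq, Subtype.dist_eq, ← hab, hc, hc]
  have hfa : ∀ i, (f ⟨a i, Set.mem_range_self i⟩ : M) = b i := fun i => dist_eq_zero.1 <| by
    change dist (b _) (b i) = 0
    rw [← hab, hc, dist_self]
  have hs : Function.Surjective f := by
    rintro ⟨_, i, rfl⟩
    exact ⟨⟨a i, Set.mem_range_self i⟩, Subtype.ext (hfa i)⟩
  obtain ⟨g, hg⟩ := h _ _ (Set.finite_range a) (Set.finite_range b)
    ⟨Equiv.ofBijective f ⟨hf.injective, hs⟩, hf⟩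
  exact ⟨g, fun i => (hg ⟨a i, Set.mem_range_self i⟩).trans (hfa i)⟩

theorem OmegaHomogeneous.exists_apply_eq (h : OmegaHomogeneous M) (x y : M) :
    ∃ g : M ≃ᵢ M, g x = y := by
  obtain ⟨g, hg⟩ := h.exists_isometryEquiv (fun _ : Unit => x) (fun _ => y) (by simp)
  exact ⟨g, hg ()⟩

theorem OmegaHomogeneous.exists_swap (h : OmegaHomogeneous M) (x y : M) :
    ∃ g : M ≃ᵢ M, g x = y ∧ g y = x := by
  obtain ⟨g, hg⟩ := h.exists_isometryEquiv (fun i : Bool => cond i x y) (fun i => cond i y x)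
    (by rintro (_ | _) (_ | _) <;> simp [dist_comm])
  exact ⟨g, hg true, hg false⟩

end Extension

/-! ### Gluings of two copies of the space -/

section BiKatetov

/-- The functions `f : M × M → ℝ` bounded by `1` that arise as distances between the points of
two copies of `M` in a common pseudometric space. -/
structure IsBiKatetov {M : Type*} [MetricSpace M] (f : M × M → ℝ) : Prop where
  le_one : ∀ x y, f (x, y) ≤ 1
  left_lipschitz : ∀ x x' y, f (x, y) ≤ dist x x' + f (x', y)
  right_lipschitz : ∀ x y y', f (x, y) ≤ f (x, y') + dist y' y
  left_triangle : ∀ x x' y, dist x x' ≤ f (x, y) + f (x', y)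
  right_triangle : ∀ x y y', dist y y' ≤ f (x, y) + f (x, y')

variable {M : Type u} [MetricSpace M] {f g : M × M → ℝ}

theorem IsBiKatetov.nonneg (hf : IsBiKatetov f) (z : M × M) : 0 ≤ f z := by
  have := hf.left_triangle z.1 z.1 z.2
  rw [dist_self] at this
  change 0 ≤ f (z.1, z.2)
  linarith

theorem isBiKatetov_dist (h : ∀ x y : M, dist x y ≤ 1) (g : M ≃ᵢ M) :
    IsBiKatetov fun z : M × M => dist z.1 (g z.2) where
  le_one x y := h _ _
  left_lipschitz x x' y := dist_triangle _ _ _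
  right_lipschitz x y y' := by
    simpa only [g.dist_eq] using dist_triangle x (g y') (g y)
  left_triangle x x' y := dist_triangle_right _ _ _
  right_triangle x y y' := by
    simpa only [g.dist_eq] using dist_triangle_left (g y) (g y') x

theorem isBiKatetov_one (h : ∀ x y : M, dist x y ≤ 1) : IsBiKatetov fun _ : M × M => (1 : ℝ) where
  le_one _ _ := le_rfl
  left_lipschitz x x' _ := by linarith [dist_nonneg (x := x) (y := x')]
  right_lipschitz _ y y' := by linarith [dist_nonneg (x := y') (y := y)]
  left_triangle x x' _ := by linarith [h x x']
  right_triangle _ y y' := by linarith [h y y']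

theorem IsBiKatetov.comp_swap (hf : IsBiKatetov f) : IsBiKatetov (f ∘ Prod.swap) where
  le_one x y := hf.le_one y x
  left_lipschitz x x' y := by
    simpa [add_comm, dist_comm] using hf.right_lipschitz y x x'
  right_lipschitz x y y' := by
    simpa [add_comm, dist_comm] using hf.left_lipschitz y y' x
  left_triangle x x' y := hf.right_triangle y x x'
  right_triangle x y y' := hf.left_triangle y y' x

/-- Truncated infima of families of candidate distance functions are bi-Katetov. -/
theorem IsBiKatetov.min_one_iInf (hM : ∀ x y : M, dist x y ≤ 1) {ι : Type*} [Nonempty ι]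
    (ρ : ι → M × M → ℝ) (h0 : ∀ i z, 0 ≤ ρ i z)
    (hl : ∀ i x x' y, ρ i (x, y) ≤ dist x x' + ρ i (x', y))
    (hr : ∀ i x y y', ρ i (x, y) ≤ ρ i (x, y') + dist y' y)
    (hl' : ∀ i j x x' y, dist x x' ≤ ρ i (x, y) + ρ j (x', y))
    (hr' : ∀ i j x y y', dist y y' ≤ ρ i (x, y) + ρ j (x, y')) :
    IsBiKatetov fun z => min 1 (⨅ i, ρ i z) := by
  have hb : ∀ z, BddBelow (Set.range fun i => ρ i z) := fun z => ⟨0, by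
    rintro _ ⟨i, rfl⟩
    exact h0 i z⟩
  have hpos : ∀ z, 0 ≤ ⨅ i, ρ i z := fun z => Real.iInf_nonneg fun i => h0 i z
  have key : ∀ z z' c, 0 ≤ c → (∀ i, ρ i z ≤ c + ρ i z') →
      min 1 (⨅ i, ρ i z) ≤ c + min 1 (⨅ i, ρ i z') := fun z z' c hc h => by
    rw [← min_add_add_left]
    refine min_le_min (by linarith) ?_
    rw [← sub_le_iff_le_add']
    exact le_ciInf fun i => by linarith [ciInf_le (hb z) i, h i]
  have key' : ∀ z z' c, c ≤ 1 → (∀ i j, c ≤ ρ i z + ρ j z') →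
      c ≤ min 1 (⨅ i, ρ i z) + min 1 (⨅ i, ρ i z') := fun z z' c hc h => by
    have h1 : c ≤ (⨅ i, ρ i z) + ⨅ i, ρ i z' := by
      rw [← sub_le_iff_le_add]
      refine le_ciInf fun i => ?_
      rw [sub_le_comm]
      exact le_ciInf fun j => by linarith [h i j]
    rcases min_choice 1 (⨅ i, ρ i z) with e | e <;>
      rcases min_choice 1 (⨅ i, ρ i z') with e' | e' <;> rw [e, e'] <;>
      linarith [hpos z, hpos z']
  exact
    { le_one := fun x y => min_le_left _ _
      left_lipschitz := fun x x' y => key _ _ _ dist_nonneg fun i => hl i x x' y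
      right_lipschitz := fun x y y' => by
        rw [add_comm]
        exact key _ _ _ dist_nonneg fun i => by rw [add_comm]; exact hr i x y y'
      left_triangle := fun x x' y => key' _ _ _ (hM _ _) fun i j => hl' i j x x' y
      right_triangle := fun x y y' => key' _ _ _ (hM _ _) fun i j => hr' i j x y y' }

/-- Every bi-Katetov function is realized by an isometry on each finite set. -/
theorem IsBiKatetov.exists_isometryEquiv (hom : OmegaHomogeneous M) (ury : IsUrysohn M)
    (hf : IsBiKatetov f) (P : Finset M) :
    ∃ k : M ≃ᵢ M, ∀ p ∈ P, ∀ q ∈ P, dist p (k q) = f (p, q) := by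
  -- Two copies of `P` at mutual distances `f`. Since `f` may vanish, this is only a pseudometric.
  let D : P ⊕ P → P ⊕ P → ℝ := fun a b => match a, b with
    | .inl p, .inl p' => dist p p'
    | .inl p, .inr q => f (p, q)
    | .inr q, .inl p => f (p, q)
    | .inr q, .inr q' => dist q q'
  let _ : PseudoMetricSpace (P ⊕ P) :=
    { dist := D
      dist_self := by rintro (a | a) <;> exact dist_self a
      dist_comm := by rintro (a | a) (b | b) <;> first | exact dist_comm a b | rfl
      dist_triangle := by
        rintro (a | a) (b | b) (c | c)
        · exact dist_triangle a b c
        · exact hf.left_lipschitz a b c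
        · exact hf.left_triangle a c b
        · exact hf.right_lipschitz a c b
        · have := hf.left_lipschitz c b a
          rw [dist_comm, add_comm] at this
          exact this
        · exact hf.right_triangle b a c
        · have := hf.right_lipschitz c a b
          rw [dist_comm, add_comm] at this
          exact this
        · exact dist_triangle a b c }
  have hD : ∀ a b : P ⊕ P, dist a b ≤ 1 := by
    rintro (a | a) (b | b)
    · exact ury.dist_le_one a b
    · exact hf.le_one a b
    · exact hf.le_one b a
    · exact ury.dist_le_one a b
  obtain ⟨φ, hφ, hφK⟩ := ury.exists_extension hD (Set.range Sum.inl)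
    (fun z => (z.2.choose : M)) (Isometry.of_dist_eq fun z w => by
      conv_rhs => rw [Subtype.dist_eq, ← z.2.choose_spec, ← w.2.choose_spec]
      rfl)
  have hφl : ∀ p : P, φ (Sum.inl p) = p := fun p => by
    have hp : (Sum.inl p : P ⊕ P) ∈ Set.range (Sum.inl : P → P ⊕ P) := Set.mem_range_self p
    rw [hφK ⟨_, hp⟩, Sum.inl_injective hp.choose_spec]
  obtain ⟨k, hk⟩ := hom.exists_isometryEquiv (fun q : P => (q : M)) (fun q => φ (Sum.inr q))
    fun q q' => (hφ.dist_eq (Sum.inr q) (Sum.inr q')).symm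
  refine ⟨k, fun p hp q hq => ?_⟩
  have := hφ.dist_eq (Sum.inl ⟨p, hp⟩) (Sum.inr ⟨q, hq⟩)
  rw [hφl, ← hk] at this
  exact this

theorem IsBiKatetov.exists_isometryEquiv₂ (hom : OmegaHomogeneous M) (ury : IsUrysohn M)
    (hf : IsBiKatetov f) (P Q : Finset M) :
    ∃ k : M ≃ᵢ M, ∀ p ∈ P, ∀ q ∈ Q, dist p (k q) = f (p, q) := by
  classical
  obtain ⟨k, hk⟩ := hf.exists_isometryEquiv hom ury (P ∪ Q)
  exact ⟨k, fun p hp q hq => hk p (Finset.mem_union_left _ hp) q (Finset.mem_union_right _ hq)⟩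

/-- Free amalgamation over a finite set. -/
theorem exists_amalgam (hom : OmegaHomogeneous M) (ury : IsUrysohn M) (C P Q : Finset M)
    [Nonempty C] :
    ∃ k : M ≃ᵢ M, (∀ c ∈ C, k c = c) ∧
      ∀ p ∈ P, ∀ q ∈ Q, dist p (k q) = min 1 (⨅ c : C, dist p c + dist (c : M) q) := by
  classical
  have hbk : IsBiKatetov fun z : M × M => min 1 (⨅ c : C, (dist z.1 c + dist (c : M) z.2)) := by
    refine IsBiKatetov.min_one_iInf ury.dist_le_one
      (fun (c : C) z => dist z.1 c + dist (c : M) z.2) (fun i z => by positivity) ?_ ?_ ?_ ?_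
    · intro i x x' y
      have := dist_triangle x x' i
      dsimp only
      linarith
    · intro i x y y'
      have := dist_triangle (i : M) y' y
      dsimp only
      linarith
    · intro i j x x' y
      have h1 := dist_triangle4 x i j x'
      have h2 := dist_triangle_right (i : M) j y
      rw [dist_comm (j : M) x'] at h1
      dsimp only
      linarith
    · intro i j x y y'
      have h1 := dist_triangle4 y i j y'
      have h2 := dist_triangle_left (i : M) j x
      rw [dist_comm y i] at h1
      dsimp only
      linarith
  obtain ⟨k, hk⟩ := hbk.exists_isometryEquiv₂ hom ury (P ∪ C) (Q ∪ C)
  refine ⟨k, fun c hc => ?_, fun p hp q hq =>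
    hk p (Finset.mem_union_left _ hp) q (Finset.mem_union_left _ hq)⟩
  have h1 := hk c (Finset.mem_union_right _ hc) c (Finset.mem_union_right _ hc)
  have h2 : (⨅ i : C, (dist c i + dist (i : M) c)) ≤ 0 := by
    refine (ciInf_le ⟨0, ?_⟩ ⟨c, hc⟩).trans (by simp)
    rintro _ ⟨i, rfl⟩
    positivity
  exact (dist_le_zero.1 (h1.le.trans ((min_le_right _ _).trans h2))).symm

/-- Isometries with close matrices of mutual distances on a finite set agree approximately on it,
up to an isometry that almost fixes the set. -/
theorem exists_approx_conj (hom : OmegaHomogeneous M) (ury : IsUrysohn M) (P : Finset M)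
    {η : ℝ} (hη : 0 < η) (g h : M ≃ᵢ M)
    (hgh : ∀ p ∈ P, ∀ q ∈ P, |dist p (g q) - dist p (h q)| ≤ 2 * η) :
    ∃ k : M ≃ᵢ M, ∀ p ∈ P, dist p (k p) ≤ η ∧ dist (g p) (k (h p)) ≤ η := by
  classical
  rcases P.eq_empty_or_nonempty with rfl | hP
  · exact ⟨1, by simp⟩
  have : Nonempty P := hP.to_subtype
  let a : P ⊕ P → M := Sum.elim (fun p => p) (fun p => g p)
  let b : P ⊕ P → M := Sum.elim (fun p => p) (fun p => h p)
  have hab : ∀ i j, |dist (a i) (a j) - dist (b i) (b j)| ≤ 2 * η := by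
    rintro (i | i) (j | j)
    · simpa [a, b] using hη.le
    · exact hgh i i.2 j j.2
    · simp only [a, b, Sum.elim_inl, Sum.elim_inr]
      rw [dist_comm (g i), dist_comm (h i)]
      exact hgh j j.2 i i.2
    · simp only [a, b, Sum.elim_inr, IsometryEquiv.dist_eq, sub_self, abs_zero]
      positivity
  -- The two configurations are joined by bridges of length `η` from `a i` to `b i`. A detour over
  -- two bridges costs `2 * η`, which absorbs the discrepancy between the distances.
  have hbk : IsBiKatetov fun z : M × M => min 1 (⨅ i, (dist z.1 (a i) + η + dist (b i) z.2)) := by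
    refine IsBiKatetov.min_one_iInf ury.dist_le_one
      (fun i z => dist z.1 (a i) + η + dist (b i) z.2) (fun i z => by positivity) ?_ ?_ ?_ ?_
    · intro i x x' y
      have := dist_triangle x x' (a i)
      dsimp only
      linarith
    · intro i x y y'
      have := dist_triangle (b i) y' y
      dsimp only
      linarith
    · intro i j x x' y
      have h1 := dist_triangle4 x (a i) (a j) x'
      have h2 := dist_triangle_right (b i) (b j) y
      have h3 := (abs_le.1 (hab i j)).2
      rw [dist_comm (a j) x'] at h1
      dsimp only
      linarith
    · intro i j x y y'
      have h1 := dist_triangle4 y (b i) (b j) y'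
      have h2 := dist_triangle_left (a i) (a j) x
      have h3 := (abs_le.1 (hab i j)).1
      rw [dist_comm y (b i)] at h1
      dsimp only
      linarith
  obtain ⟨k, hk⟩ := hbk.exists_isometryEquiv₂ hom ury
    (Finset.univ.image a) (Finset.univ.image b)
  have hk' : ∀ i, dist (a i) (k (b i)) ≤ η := fun i => by
    rw [hk _ (Finset.mem_image_of_mem a (Finset.mem_univ i)) _
      (Finset.mem_image_of_mem b (Finset.mem_univ i))]
    refine (min_le_right _ _).trans ((ciInf_le ⟨0, ?_⟩ i).trans (by simp))
    rintro _ ⟨i, rfl⟩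
    positivity
  exact ⟨k, fun p hp => ⟨hk' (Sum.inl ⟨p, hp⟩), hk' (Sum.inr ⟨p, hp⟩)⟩⟩

theorem exists_dist_eq_one (hom : OmegaHomogeneous M) (ury : IsUrysohn M) (P : Finset M) :
    ∃ k : M ≃ᵢ M, ∀ p ∈ P, ∀ q ∈ P, dist p (k q) = 1 :=
  (isBiKatetov_one ury.dist_le_one).exists_isometryEquiv hom ury P

/-- A finite `M` would have a copy of itself at distance `1` from all of `M`. Infinitude makes the
cardinal arithmetic for the weights work. -/
theorem infinite_of_isUrysohn (hom : OmegaHomogeneous M) (ury : IsUrysohn M) : Infinite M := by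
  by_contra hM
  rw [not_infinite_iff_finite] at hM
  have := Fintype.ofFinite M
  obtain ⟨x⟩ := ury.nonempty
  obtain ⟨k, hk⟩ := exists_dist_eq_one hom ury Finset.univ
  have := hk (k x) (Finset.mem_univ _) x (Finset.mem_univ _)
  rw [dist_self] at this
  exact zero_ne_one this

end BiKatetov

/-! ### Pointwise convergence, completeness and Roelcke precompactness -/

open Filter Topology Uniformity

theorem mem_nhds_pi_dist_iff {X Y : Type*} [PseudoMetricSpace Y] {f : X → Y} {s : Set (X → Y)} :
    s ∈ 𝓝 f ↔ ∃ P : Finset X, ∃ ε > 0, ∀ h : X → Y, (∀ x ∈ P, dist (h x) (f x) < ε) → h ∈ s := by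
  constructor
  · intro hs
    rw [nhds_pi, Filter.mem_pi] at hs
    obtain ⟨I, hI, t, ht, hts⟩ := hs
    have hev : ∀ᶠ ε : ℝ in 𝓝[>] 0, ∀ i ∈ I, Metric.ball (f i) ε ⊆ t i := by
      refine (Filter.eventually_all_finite hI).2 fun i _ => ?_
      obtain ⟨δ, hδ, hδt⟩ := Metric.mem_nhds_iff.1 (ht i)
      filter_upwards [Ioo_mem_nhdsGT hδ] with ε hε
      exact (Metric.ball_subset_ball hε.2.le).trans hδt
    obtain ⟨ε, hε, hε0⟩ := (hev.and self_mem_nhdsWithin).exists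
    exact ⟨hI.toFinset, ε, hε0, fun h hh =>
      hts fun i hi => hε i hi (hh i (hI.mem_toFinset.2 hi))⟩
  · rintro ⟨P, ε, hε, h⟩
    refine mem_of_superset ?_ h
    refine (Filter.eventually_all_finset P).2 fun x _ => ?_
    exact (continuous_apply x).continuousAt (Metric.ball_mem_nhds (f x) hε)

section IsometryGroup

variable {M : Type u} [MetricSpace M]

theorem mem_nhds_isometryEquiv_iff {g : M ≃ᵢ M} {s : Set (M ≃ᵢ M)} :
    s ∈ 𝓝 g ↔ ∃ P : Finset M, ∃ ε > 0, ∀ h : M ≃ᵢ M, (∀ x ∈ P, dist (h x) (g x) < ε) → h ∈ s := by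
  rw [nhds_induced, Filter.mem_comap]
  constructor
  · rintro ⟨t, ht, hts⟩
    obtain ⟨P, ε, hε, h⟩ := mem_nhds_pi_dist_iff.1 ht
    exact ⟨P, ε, hε, fun k hk => hts (h _ hk)⟩
  · rintro ⟨P, ε, hε, h⟩
    exact ⟨{k | ∀ x ∈ P, dist (k x) (g x) < ε}, mem_nhds_pi_dist_iff.2 ⟨P, ε, hε, fun _ => id⟩,
      fun k hk => h k hk⟩

theorem tendsto_nhds_isometryEquiv_iff {α : Type*} {F : Filter α} {u : α → M ≃ᵢ M} {g : M ≃ᵢ M} :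
    Tendsto u F (𝓝 g) ↔ ∀ x, Tendsto (fun a => u a x) F (𝓝 (g x)) := by
  rw [nhds_induced, tendsto_comap_iff, tendsto_pi_nhds]
  rfl

instance : T2Space (M ≃ᵢ M) :=
  T2Space.of_injective_continuous (f := fun (g : M ≃ᵢ M) (x : M) => g x)
    (fun _ _ h => IsometryEquiv.ext (congrFun h)) continuous_induced_dom

theorem exists_tendsto_apply [CompleteSpace M] {F : Filter (M ≃ᵢ M)} [NeBot F]
    (hF : Tendsto (fun p : (M ≃ᵢ M) × (M ≃ᵢ M) => p.1⁻¹ * p.2) (F ×ˢ F) (𝓝 1)) (x : M) :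
    ∃ y, Tendsto (fun g : M ≃ᵢ M => g x) F (𝓝 y) := by
  have hc : Cauchy (map (fun g : M ≃ᵢ M => g x) F) := by
    refine cauchy_map_iff.2 ⟨inferInstance, tendsto_uniformity_iff_dist_tendsto_zero.2 ?_⟩
    have h1 := tendsto_iff_dist_tendsto_zero.1 (tendsto_nhds_isometryEquiv_iff.1 hF x)
    refine h1.congr fun p => ?_
    rw [← p.1.dist_eq, IsometryEquiv.mul_apply, IsometryEquiv.apply_inv_self, dist_comm]
    rfl
  exact CompleteSpace.complete hc

/-- The left Cauchy condition yields a pointwise limit of `g`, the right one a pointwise limit of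
`g⁻¹`; the two limits are mutually inverse, which gives surjectivity. -/
theorem rajkovComplete_isometryEquiv [CompleteSpace M] : RajkovComplete (M ≃ᵢ M) := by
  refine @CompleteSpace.mk _ (upperUniformity (M ≃ᵢ M)) fun {F} hF => ?_
  have hne : NeBot F := hF.1
  have hle := hF.2
  rw [inf_uniformity, le_inf_iff] at hle
  have hL : Tendsto (fun p : (M ≃ᵢ M) × (M ≃ᵢ M) => p.1⁻¹ * p.2) (F ×ˢ F) (𝓝 1) :=
    map_le_iff_le_comap.2 hle.1
  have hR : Tendsto (fun p : (M ≃ᵢ M) × (M ≃ᵢ M) => p.2 * p.1⁻¹) (F ×ˢ F) (𝓝 1) :=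
    map_le_iff_le_comap.2 hle.2
  have hR' : Tendsto (fun p : (M ≃ᵢ M) × (M ≃ᵢ M) => p.1⁻¹ * p.2)
      (map Inv.inv F ×ˢ map Inv.inv F) (𝓝 1) := by
    rw [Filter.prod_map_map_eq, tendsto_map'_iff]
    simpa [Function.comp_def] using hR.inv
  choose φ hφ using fun x => exists_tendsto_apply hL x
  choose ψ hψ using fun x => exists_tendsto_apply hR' x
  simp only [tendsto_map'_iff, Function.comp_def] at hψ
  let e : M ≃ᵢ M :=
    { toFun := φ
      invFun := ψ
      left_inv := fun x => by
        refine tendsto_nhds_unique (hψ (φ x)) (tendsto_iff_dist_tendsto_zero.2 ?_)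
        refine (tendsto_iff_dist_tendsto_zero.1 (hφ x)).congr fun g => ?_
        rw [← g.dist_eq (g⁻¹ (φ x)), IsometryEquiv.apply_inv_self, dist_comm]
      right_inv := fun x => by
        refine tendsto_nhds_unique (hφ (ψ x)) (tendsto_iff_dist_tendsto_zero.2 ?_)
        refine (tendsto_iff_dist_tendsto_zero.1 (hψ x)).congr fun g => ?_
        rw [← g.dist_eq (g⁻¹ x), IsometryEquiv.apply_inv_self, dist_comm]
      isometry_toFun := Isometry.of_dist_eq fun x y => by
        refine tendsto_nhds_unique ((hφ x).dist (hφ y)) ?_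
        simp only [IsometryEquiv.dist_eq]
        exact tendsto_const_nhds }
  have he : F ≤ 𝓝 e := tendsto_nhds_isometryEquiv_iff.2 hφ
  refine ⟨e, ?_⟩
  rw [UniformSpace.toTopologicalSpace_inf]
  exact he.trans (by rw [nhds_inf]; exact le_inf le_rfl le_rfl)

/-- The function `(x, y) ↦ dist x (g y)` attached to an isometry `g`. -/
def distFun (g : M ≃ᵢ M) : M × M → ℝ := fun z => dist z.1 (g z.2)

theorem isCompact_setOf_isBiKatetov : IsCompact {f : M × M → ℝ | IsBiKatetov f} := by
  have hc : IsClosed {f : M × M → ℝ | IsBiKatetov f} := by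
    have : {f : M × M → ℝ | IsBiKatetov f} =
        {f | ∀ x y, f (x, y) ≤ 1} ∩ {f | ∀ x x' y, f (x, y) ≤ dist x x' + f (x', y)} ∩
        {f | ∀ x y y', f (x, y) ≤ f (x, y') + dist y' y} ∩
        {f | ∀ x x' y, dist x x' ≤ f (x, y) + f (x', y)} ∩
        {f | ∀ x y y', dist y y' ≤ f (x, y) + f (x, y')} := by
      ext f
      exact ⟨fun h => ⟨⟨⟨⟨h.1, h.2⟩, h.3⟩, h.4⟩, h.5⟩,
        fun h => ⟨h.1.1.1.1, h.1.1.1.2, h.1.1.2, h.1.2, h.2⟩⟩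
    rw [this]
    simp only [Set.ofPred_forall]
    refine (((IsClosed.inter ?_ ?_).inter ?_).inter ?_).inter ?_
    all_goals
      repeat refine isClosed_iInter fun _ => ?_
      exact isClosed_le (by fun_prop) (by fun_prop)
  refine IsCompact.of_isClosed_subset
    (isCompact_univ_pi fun _ : M × M => isCompact_Icc (a := (0 : ℝ)) (b := 1)) hc fun f hf z _ => ?_
  exact ⟨hf.nonneg z, hf.le_one z.1 z.2⟩

theorem roelckePrecompact_isometryEquiv (hom : OmegaHomogeneous M) (ury : IsUrysohn M) :
    RoelckePrecompact (M ≃ᵢ M) := by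
  classical
  intro E hE
  obtain ⟨E', hE', hEE⟩ := @comp_mem_uniformity_sets _ (roelckeUniformity (M ≃ᵢ M)) _ hE
  have hEL : E' ∈ 𝓤[IsTopologicalGroup.leftUniformSpace (M ≃ᵢ M)] :=
    UniformSpace.le_def.1 (le_sup_left : _ ≤ roelckeUniformity (M ≃ᵢ M)) hE'
  have hER : E' ∈ 𝓤[IsTopologicalGroup.rightUniformSpace (M ≃ᵢ M)] :=
    UniformSpace.le_def.1 (le_sup_right : _ ≤ roelckeUniformity (M ≃ᵢ M)) hE'
  obtain ⟨U, hU, hUE⟩ := Filter.mem_comap.1 hEL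
  obtain ⟨V, hV, hVE⟩ := Filter.mem_comap.1 hER
  obtain ⟨P, ε, hε, hP⟩ := mem_nhds_isometryEquiv_iff.1 (Filter.inter_mem hU hV)
  have htb : TotallyBounded (Set.range (distFun : (M ≃ᵢ M) → M × M → ℝ)) :=
    isCompact_setOf_isBiKatetov.totallyBounded.subset (by
      rintro _ ⟨g, rfl⟩
      exact isBiKatetov_dist ury.dist_le_one g)
  have hent : {q : (M × M → ℝ) × (M × M → ℝ) | ∀ z ∈ P ×ˢ P, dist (q.1 z) (q.2 z) < ε} ∈
      𝓤 (M × M → ℝ) := by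
    refine (Filter.eventually_all_finset (P ×ˢ P)).2 fun z _ => ?_
    rw [Pi.uniformity]
    exact mem_iInf_of_mem z (preimage_mem_comap (Metric.dist_mem_uniformity hε))
  obtain ⟨t, hts, htf, ht⟩ := totallyBounded_iff_subset.1 htb _ hent
  have hts' : ∀ f ∈ t, ∃ g : M ≃ᵢ M, distFun g = f := fun f hf => hts hf
  choose! c hc using hts'
  refine ⟨c '' t, htf.image c, fun g _ => ?_⟩
  have hg := ht ⟨g, rfl⟩
  simp only [Set.mem_iUnion] at hg ⊢
  obtain ⟨f, hft, hf⟩ := hg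
  refine ⟨c f, ⟨f, hft, rfl⟩, hEE ?_⟩
  obtain ⟨k, hk⟩ := exists_approx_conj hom ury P (half_pos hε) (c f) g fun p hp q hq => by
    have h1 := hf (p, q) (Finset.mk_mem_product hp hq)
    rw [← hc f hft, dist_comm] at h1
    rw [mul_div_cancel₀ _ two_ne_zero]
    exact h1.le
  -- The intermediate point `k * g` is right-close to `g`, as `k` almost fixes `P`, and left-close
  -- to `c f`, as both nearly agree on `P`.
  refine ⟨k * g, hVE ?_, hUE ?_⟩
  · refine (hP _ fun x hx => ?_).2
    change dist ((k * g * g⁻¹) x) x < ε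
    rw [mul_inv_cancel_right, dist_comm]
    exact (hk x hx).1.trans_lt (half_lt_self hε)
  · refine (hP _ fun x hx => ?_).1
    change dist ((k * g)⁻¹ (c f x)) x < ε
    rw [← (k * g).dist_eq, IsometryEquiv.apply_inv_self]
    exact (hk x hx).2.trans_lt (half_lt_self hε)

end IsometryGroup

/-! ### Comparison of weights -/

section Weight

theorem weight_le_mk {X ι : Type u} [TopologicalSpace X] (B : ι → Set X)
    (hB : TopologicalSpace.IsTopologicalBasis (Set.range B)) : weight X ≤ Cardinal.mk ι :=
  (csInf_le' (show Cardinal.mk (Set.range B) ∈ {c : Cardinal.{u} | ∃ B : Set (Set X),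
    TopologicalSpace.IsTopologicalBasis B ∧ Cardinal.mk B = c} from ⟨_, hB, rfl⟩)).trans Cardinal.mk_range_le

theorem exists_basis_mk_eq_weight (X : Type u) [TopologicalSpace X] :
    ∃ B : Set (Set X), TopologicalSpace.IsTopologicalBasis B ∧ Cardinal.mk B = weight X :=
  csInf_mem (s := {c : Cardinal.{u} |
    ∃ B : Set (Set X), TopologicalSpace.IsTopologicalBasis B ∧ Cardinal.mk B = c})
    ⟨Cardinal.mk {U : Set X | IsOpen U}, _, TopologicalSpace.isTopologicalBasis_opens, rfl⟩

/-- A selection of points from the sets of a base has dense range. -/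
theorem exists_selection {X : Type u} [TopologicalSpace X] [Nonempty X] {B : Set (Set X)}
    (hB : TopologicalSpace.IsTopologicalBasis B) :
    ∃ p : B → X, ∀ (x : X) (U : Set X), IsOpen U → x ∈ U → ∃ b : B, x ∈ (b : Set X) ∧
      (b : Set X) ⊆ U ∧ p b ∈ (b : Set X) := by
  classical
  refine ⟨fun b => if h : (b : Set X).Nonempty then h.some else Classical.arbitrary X,
    fun x U hU hx => ?_⟩
  obtain ⟨b, hb, hxb, hbU⟩ := hB.exists_subset_of_mem_open hx hU
  refine ⟨⟨b, hb⟩, hxb, hbU, ?_⟩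
  have hne : b.Nonempty := ⟨x, hxb⟩
  simp only [hne, dif_pos]
  exact hne.some_mem

theorem infinite_of_denseRange {X : Type*} {ι : Type*} [TopologicalSpace X] [T1Space X] [Infinite X]
    {p : ι → X} (hp : DenseRange p) : Infinite ι := by
  by_contra h
  rw [not_infinite_iff_finite] at h
  have h1 := (Set.finite_range p).isClosed.closure_eq
  rw [hp.closure_range] at h1
  exact Set.infinite_univ (h1 ▸ Set.finite_range p)

variable {M : Type u} [MetricSpace M]

/-- Isometries being 1-Lipschitz, finitely many conditions "a point of a dense set goes into a basic
set" suffice. For infinite `B` there are only as many such finite sets of conditions as elements of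
`B`. -/
theorem weight_isometryEquiv_le [Infinite M] : weight (M ≃ᵢ M) ≤ weight M := by
  classical
  obtain ⟨B, hB, hBw⟩ := exists_basis_mk_eq_weight M
  obtain ⟨p, hp⟩ := exists_selection hB
  have hd : DenseRange p := fun x => mem_closure_iff.2 fun U hU hx => by
    obtain ⟨b, -, hbU, hpb⟩ := hp x U hU hx
    exact ⟨p b, hbU hpb, b, rfl⟩
  have hinf : Infinite B := infinite_of_denseRange hd
  let W : Finset (B × B) → Set (M ≃ᵢ M) := fun s => {g | ∀ q ∈ s, g (p q.1) ∈ (q.2 : Set M)}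
  have hW : TopologicalSpace.IsTopologicalBasis (Set.range W) := by
    refine TopologicalSpace.isTopologicalBasis_of_isOpen_of_nhds ?_ ?_
    · rintro _ ⟨s, rfl⟩
      have : W s = ⋂ q ∈ s, (fun g : M ≃ᵢ M => g (p q.1)) ⁻¹' (q.2 : Set M) := by
        ext g
        simp [W]
      rw [this]
      exact isOpen_biInter_finset fun q _ => (hB.isOpen q.2.2).preimage (continuous_eval _)
    · intro g U hg hU
      obtain ⟨P, ε, hε, hP⟩ := mem_nhds_isometryEquiv_iff.1 (hU.mem_nhds hg)
      have h4 : 0 < ε / 4 := by positivity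
      have hx : ∀ x : M, ∃ q : B × B, dist x (p q.1) < ε / 4 ∧ g (p q.1) ∈ (q.2 : Set M) ∧
          (q.2 : Set M) ⊆ Metric.ball (g (p q.1)) (ε / 4) := fun x => by
        obtain ⟨b, hb⟩ := hd.exists_dist_lt x h4
        obtain ⟨b', h1, h2, -⟩ := hp (g (p b)) _ Metric.isOpen_ball (Metric.mem_ball_self h4)
        exact ⟨⟨b, b'⟩, hb, h1, h2⟩
      choose c hc1 hc2 hc3 using hx
      refine ⟨_, ⟨P.image c, rfl⟩, ?_, fun h hh => hP h fun x hx => ?_⟩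
      · intro q hq
        obtain ⟨x, -, rfl⟩ := Finset.mem_image.1 hq
        exact hc2 x
      · have h1 := hc3 x (hh _ (Finset.mem_image_of_mem c hx))
        rw [Metric.mem_ball] at h1
        have h2 := dist_triangle4 (h x) (h (p (c x).1)) (g (p (c x).1)) (g x)
        rw [h.dist_eq, g.dist_eq, dist_comm _ x] at h2
        linarith [hc1 x]
  refine (weight_le_mk W hW).trans (le_of_eq ?_)
  rw [Cardinal.mk_finset_of_infinite, Cardinal.mk_prod, Cardinal.lift_id,
    Cardinal.mul_eq_self (Cardinal.aleph0_le_mk B), hBw]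

/-- By transitivity the orbit map at `x₀` carries a dense set of isometries to a dense set of
points; balls of radius `1 / (n + 1)` around these form a base. -/
theorem weight_le_weight_isometryEquiv [Infinite M] (hom : OmegaHomogeneous M) :
    weight M ≤ weight (M ≃ᵢ M) := by
  obtain ⟨B, hB, hBw⟩ := exists_basis_mk_eq_weight (M ≃ᵢ M)
  obtain ⟨p, hp⟩ := exists_selection hB
  obtain ⟨x₀⟩ : Nonempty M := inferInstance
  have hd : DenseRange fun b => p b x₀ := fun x => mem_closure_iff.2 fun U hU hx => by
    obtain ⟨g, rfl⟩ := hom.exists_apply_eq x₀ x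
    obtain ⟨b, -, hbU, hpb⟩ := hp g _ (hU.preimage (continuous_eval x₀)) hx
    exact ⟨p b x₀, hbU hpb, b, rfl⟩
  have hinf : Infinite B := infinite_of_denseRange hd
  let W : B × ℕ → Set M := fun q => Metric.ball (p q.1 x₀) (1 / (q.2 + 1))
  have hW : TopologicalSpace.IsTopologicalBasis (Set.range W) := by
    refine TopologicalSpace.isTopologicalBasis_of_isOpen_of_nhds ?_ ?_
    · rintro _ ⟨s, rfl⟩
      exact Metric.isOpen_ball
    · intro x U hx hU
      obtain ⟨ε, hε, hεU⟩ := Metric.isOpen_iff.1 hU x hx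
      obtain ⟨n, hn⟩ := exists_nat_one_div_lt (half_pos hε)
      obtain ⟨b, hb⟩ := hd.exists_dist_lt x (Nat.one_div_pos_of_nat (n := n) (α := ℝ))
      refine ⟨_, ⟨(b, n), rfl⟩, hb, fun y hy => hεU ?_⟩
      have hy' : dist y (p b x₀) < 1 / (n + 1) := hy
      rw [Metric.mem_ball]
      linarith [dist_triangle_right y x (p b x₀)]
  refine (weight_le_mk W hW).trans (le_of_eq ?_)
  rw [Cardinal.mk_prod, Cardinal.lift_uzero, Cardinal.mk_nat, Cardinal.lift_aleph0,
    Cardinal.mul_aleph0_eq (Cardinal.aleph0_le_mk B), hBw]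

end Weight

/-- The filter `F` is the neighbourhood filter of `1` for some group topology coarser than the
given one. -/
structure IsCoarserNhdsOne {G : Type*} [Group G] [TopologicalSpace G] (F : Filter G) : Prop where
  nhds_le : 𝓝 1 ≤ F
  mul : Tendsto (fun p : G × G => p.1 * p.2) (F ×ˢ F) F
  inv : Tendsto (fun g : G => g⁻¹) F F
  conj : ∀ h : G, Tendsto (fun g => h * g * h⁻¹) F F

namespace IsCoarserNhdsOne

section Group

theorem of_le {G : Type*} [Group G] {t t' : TopologicalSpace G} (h : t ≤ t')
    (hG : @IsTopologicalGroup G t' _) : @IsCoarserNhdsOne G _ t (@nhds G t' 1) := by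
  refine @IsCoarserNhdsOne.mk G _ t _ (nhds_mono h) ?_ ?_ fun k => ?_
  · simpa [nhds_prod_eq] using (continuous_mul (M := G)).tendsto (1, 1)
  · simpa using (continuous_inv (G := G)).tendsto 1
  · have : Continuous fun g : G => k * g * k⁻¹ := by fun_prop
    simpa using this.tendsto 1

variable {G : Type*} [Group G] [TopologicalSpace G] {F : Filter G}

theorem one_mem (hF : IsCoarserNhdsOne F) {U : Set G} (hU : U ∈ F) : (1 : G) ∈ U :=
  mem_of_mem_nhds (hF.nhds_le hU)

theorem exists_mul_mem (hF : IsCoarserNhdsOne F) {U : Set G} (hU : U ∈ F) :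
    ∃ V ∈ F, ∀ a ∈ V, ∀ b ∈ V, ∀ c ∈ V, a * b * c ∈ U := by
  obtain ⟨V, hV, hVU⟩ := mem_prod_same_iff.1 (hF.mul hU)
  obtain ⟨W, hW, hWV⟩ := mem_prod_same_iff.1 (hF.mul hV)
  refine ⟨V ∩ W, inter_mem hV hW, fun a ha b hb c hc => ?_⟩
  exact hVU (Set.mk_mem_prod (hWV (Set.mk_mem_prod ha.2 hb.2)) hc.1)

end Group

variable {M : Type u} [MetricSpace M] {F : Filter (M ≃ᵢ M)}

theorem exists_finset (hF : IsCoarserNhdsOne F) {U : Set (M ≃ᵢ M)} (hU : U ∈ F) :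
    ∃ A : Finset M, ∀ k : M ≃ᵢ M, (∀ a ∈ A, k a = a) → k ∈ U := by
  obtain ⟨A, ε, hε, hA⟩ := mem_nhds_isometryEquiv_iff.1 (hF.nhds_le hU)
  refine ⟨A, fun k hk => hA k fun a ha => ?_⟩
  rw [hk a ha]
  change dist a a < ε
  rwa [dist_self]

end IsCoarserNhdsOne

/-! ### Cluster points along a coarser group topology -/

section ClusterPoints

variable {M : Type u} [MetricSpace M] {F : Filter (M ≃ᵢ M)} {f g : M × M → ℝ}

theorem mapClusterPt_distFun_iff : MapClusterPt f F distFun ↔ ∀ (P : Finset M), ∀ ε > 0,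
    ∃ᶠ g in F, ∀ x ∈ P, ∀ y ∈ P, |dist x (g y) - f (x, y)| < ε := by
  classical
  constructor
  · intro h P ε hε
    have h1 : {k : M × M → ℝ | ∀ z ∈ P ×ˢ P, dist (k z) (f z) < ε} ∈ 𝓝 f :=
      mem_nhds_pi_dist_iff.2 ⟨P ×ˢ P, ε, hε, fun _ => id⟩
    exact (mapClusterPt_iff_frequently.1 h _ h1).mono fun g hg x hx y hy =>
      hg (x, y) (Finset.mk_mem_product hx hy)
  · intro h
    refine mapClusterPt_iff_frequently.2 fun s hs => ?_
    obtain ⟨Q, ε, hε, hQ⟩ := mem_nhds_pi_dist_iff.1 hs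
    refine (h (Q.image Prod.fst ∪ Q.image Prod.snd) ε hε).mono fun g hg => hQ _ fun z hz => ?_
    exact hg z.1 (Finset.mem_union_left _ (Finset.mem_image_of_mem _ hz)) z.2
      (Finset.mem_union_right _ (Finset.mem_image_of_mem _ hz))

theorem isBiKatetov_of_mapClusterPt (hM : ∀ x y : M, dist x y ≤ 1)
    (h : MapClusterPt f F distFun) : IsBiKatetov f := by
  by_contra hf
  have h1 := isCompact_setOf_isBiKatetov.isClosed.isOpen_compl.mem_nhds
    (show f ∈ {f : M × M → ℝ | IsBiKatetov f}ᶜ from hf)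
  obtain ⟨g, hg⟩ := (mapClusterPt_iff_frequently.1 h _ h1).exists
  exact hg (isBiKatetov_dist hM g)

theorem isCompact_setOf_mapClusterPt (hM : ∀ x y : M, dist x y ≤ 1) :
    IsCompact {f | MapClusterPt f F (distFun (M := M))} :=
  isCompact_setOf_isBiKatetov.of_isClosed_subset isClosed_setOfPred_clusterPt
    fun _ h => isBiKatetov_of_mapClusterPt hM h

/-- The composition of two bi-Katetov functions. -/
noncomputable def bicomp (f g : M × M → ℝ) : M × M → ℝ :=
  fun z => min 1 (⨅ w, (f (z.1, w) + g (w, z.2)))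

theorem bddBelow_bicomp (hf : IsBiKatetov f) (hg : IsBiKatetov g) (x y : M) :
    BddBelow (Set.range fun w => f (x, w) + g (w, y)) := by
  refine ⟨0, ?_⟩
  rintro _ ⟨w, rfl⟩
  exact add_nonneg (hf.nonneg _) (hg.nonneg _)

theorem le_bicomp [Nonempty M] (hf : IsBiKatetov f) (hg : ∀ x y : M, dist x y ≤ g (x, y)) (x y : M) :
    f (x, y) ≤ bicomp f g (x, y) :=
  le_min (hf.le_one x y) (le_ciInf fun w => by linarith [hf.right_lipschitz x y w, hg w y])

theorem le_bicomp' [Nonempty M] (hg : IsBiKatetov g) (hf : ∀ x y : M, dist x y ≤ f (x, y)) (x y : M) :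
    g (x, y) ≤ bicomp f g (x, y) :=
  le_min (hg.le_one x y) (le_ciInf fun w => by linarith [hg.left_lipschitz x w y, hf x w])

namespace IsCoarserNhdsOne

theorem mapClusterPt_dist (hF : IsCoarserNhdsOne F) : MapClusterPt (distFun (1 : M ≃ᵢ M)) F distFun :=
  mapClusterPt_distFun_iff.2 fun P ε hε => frequently_iff.2 fun hU =>
    ⟨1, hF.one_mem hU, fun x _ y _ => by simpa [distFun] using hε⟩

theorem mapClusterPt_swap (hF : IsCoarserNhdsOne F) (h : MapClusterPt f F distFun) :
    MapClusterPt (f ∘ Prod.swap) F distFun := by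
  refine mapClusterPt_distFun_iff.2 fun P ε hε => ?_
  refine hF.inv.frequently ((mapClusterPt_distFun_iff.1 h P ε hε).mono fun g hg x hx y hy => ?_)
  rw [← g.dist_eq, IsometryEquiv.apply_inv_self, dist_comm]
  exact hg y hy x hx

theorem mapClusterPt_conj (hF : IsCoarserNhdsOne F) (h : MapClusterPt f F distFun) (φ : M ≃ᵢ M) :
    MapClusterPt (fun z => f (φ z.1, φ z.2)) F distFun := by
  classical
  refine mapClusterPt_distFun_iff.2 fun P ε hε => ?_
  refine (hF.conj φ⁻¹).frequently
    ((mapClusterPt_distFun_iff.1 h (P.image φ) ε hε).mono fun g hg x hx y hy => ?_)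
  rw [← φ.dist_eq]
  simpa using hg _ (Finset.mem_image_of_mem φ hx) _ (Finset.mem_image_of_mem φ hy)

/-- Choose small `a`, `b` approximating `f`, `g`, and let `k` fix a finite set `Q` and amalgamate
freely over it. The distance from `x` to `a (k (b y))` is then the shortest path through `Q`, a
finite version of the infimum defining `bicomp`. -/
theorem mapClusterPt_bicomp (hF : IsCoarserNhdsOne F) (hom : OmegaHomogeneous M) (ury : IsUrysohn M)
    (hf : MapClusterPt f F distFun) (hg : MapClusterPt g F distFun) :
    MapClusterPt (bicomp f g) F distFun := by
  classical
  have := ury.nonempty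
  have hfb := isBiKatetov_of_mapClusterPt ury.dist_le_one hf
  have hgb := isBiKatetov_of_mapClusterPt ury.dist_le_one hg
  refine mapClusterPt_distFun_iff.2 fun P ε hε => frequently_iff.2 fun {U} hU => ?_
  obtain ⟨V, hV, hVU⟩ := hF.exists_mul_mem hU
  obtain ⟨A, hA⟩ := hF.exists_finset hV
  have h4 : 0 < ε / 4 := by positivity
  choose w hw using fun z : M × M =>
    exists_lt_of_ciInf_lt (lt_add_of_pos_right (⨅ w, (f (z.1, w) + g (w, z.2))) h4)
  obtain ⟨x₀⟩ := ury.nonempty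
  -- `A` keeps `k` in `V`, the points `w` nearly attain the infima, and `x₀` makes `Q` nonempty.
  let Q : Finset M := insert x₀ (A ∪ P ∪ (P ×ˢ P).image w)
  have hAQ : A ⊆ Q := fun a ha => by simp [Q, ha]
  have hPQ : P ⊆ Q := fun a ha => by simp [Q, ha]
  have hwQ : ∀ x ∈ P, ∀ y ∈ P, w (x, y) ∈ Q := fun x hx y hy =>
    Finset.mem_insert_of_mem (Finset.mem_union_right _
      (Finset.mem_image_of_mem w (Finset.mk_mem_product hx hy)))
  have hQ : Nonempty Q := ⟨⟨x₀, Finset.mem_insert_self _ _⟩⟩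
  obtain ⟨a, haV, ha⟩ := frequently_iff.1 (mapClusterPt_distFun_iff.1 hf Q _ h4) hV
  obtain ⟨b, hbV, hb⟩ := frequently_iff.1 (mapClusterPt_distFun_iff.1 hg Q _ h4) hV
  obtain ⟨k, hkQ, hk⟩ := exists_amalgam hom ury Q (P.image ⇑a⁻¹) (P.image b)
  refine ⟨a * k * b, hVU a haV k (hA k fun c hc => hkQ c (hAQ hc)) b hbV, fun x hx y hy => ?_⟩
  have h1 := hk _ (Finset.mem_image_of_mem _ hx) _ (Finset.mem_image_of_mem _ hy)
  have h2 : ∀ c : M, dist (a⁻¹ x) c = dist x (a c) := fun c => by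
    rw [← a.dist_eq, IsometryEquiv.apply_inv_self]
  simp only [h2] at h1
  rw [IsometryEquiv.mul_apply, IsometryEquiv.mul_apply, h1]
  refine (abs_min_sub_min_le_max _ _ _ _).trans_lt ?_
  rw [sub_self, abs_zero, max_eq_right (abs_nonneg _)]
  have hbdd : BddBelow (Set.range fun c : Q => dist x (a c) + dist (c : M) (b y)) := by
    refine ⟨0, ?_⟩
    rintro _ ⟨w, rfl⟩
    positivity
  rw [abs_lt]
  constructor
  · have : (⨅ w, (f (x, w) + g (w, y))) - ε / 2 ≤ ⨅ c : Q, (dist x (a c) + dist (c : M) (b y)) := by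
      refine le_ciInf fun c => ?_
      have h3 := (abs_lt.1 (ha x (hPQ hx) c c.2)).1
      have h4 := (abs_lt.1 (hb c c.2 y (hPQ hy))).1
      have h5 := ciInf_le (bddBelow_bicomp hfb hgb x y) c
      linarith
    dsimp only
    linarith
  · have h3 := (abs_lt.1 (ha x (hPQ hx) _ (hwQ x hx y hy))).2
    have h4 := (abs_lt.1 (hb _ (hwQ x hx y hy) y (hPQ hy))).2
    have h5 := ciInf_le hbdd ⟨_, hwQ x hx y hy⟩
    have h6 := hw (x, y)
    dsimp only at h5 h6 ⊢
    linarith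

/-- Among the cluster points that dominate the metric there is a largest one. -/
theorem exists_greatest (hF : IsCoarserNhdsOne F) (hom : OmegaHomogeneous M) (ury : IsUrysohn M) :
    ∃ e, MapClusterPt e F distFun ∧ (∀ x y : M, dist x y ≤ e (x, y)) ∧
      ∀ u, MapClusterPt u F distFun → (∀ x y : M, dist x y ≤ u (x, y)) → u ≤ e := by
  have := ury.nonempty
  let T := {u : M × M → ℝ // MapClusterPt u F distFun ∧ ∀ x y : M, dist x y ≤ u (x, y)}
  have d : T := ⟨_, hF.mapClusterPt_dist, fun _ _ => le_rfl⟩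
  have : Nonempty T := ⟨d⟩
  let K : T → Set (M × M → ℝ) := fun u => {f | MapClusterPt f F distFun} ∩ Set.Ici u.1
  have hK : ∀ u, IsCompact (K u) := fun u =>
    (isCompact_setOf_mapClusterPt ury.dist_le_one).inter_right isClosed_Ici
  obtain ⟨e, he⟩ := IsCompact.nonempty_iInter_of_directed_nonempty_isCompact_isClosed K
    -- Directedness: the composition of two elements above the metric dominates both.
    (fun u v => by
      have hu := isBiKatetov_of_mapClusterPt ury.dist_le_one u.2.1
      have hv := isBiKatetov_of_mapClusterPt ury.dist_le_one v.2.1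
      have h1 : u.1 ≤ bicomp u.1 v.1 := fun z => le_bicomp hu v.2.2 z.1 z.2
      have h2 : v.1 ≤ bicomp u.1 v.1 := fun z => le_bicomp' hv u.2.2 z.1 z.2
      refine ⟨⟨bicomp u.1 v.1, hF.mapClusterPt_bicomp hom ury u.2.1 v.2.1,
        fun x y => (u.2.2 x y).trans (h1 (x, y))⟩, ?_, ?_⟩
      · exact Set.inter_subset_inter_right _ (Set.Ici_subset_Ici.2 h1)
      · exact Set.inter_subset_inter_right _ (Set.Ici_subset_Ici.2 h2))
    (fun u => ⟨u.1, u.2.1, Set.self_mem_Ici⟩) hK fun u => (hK u).isClosed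
  rw [Set.mem_iInter] at he
  refine ⟨e, (he d).1, fun x y => (he ⟨_, hF.mapClusterPt_dist, fun _ _ => le_rfl⟩).2 (x, y), fun u hu hdu => (he ⟨u, hu, hdu⟩).2⟩

/-- The largest cluster point dominating the metric is an invariant idempotent, hence it either
vanishes on the diagonal or is at least `1` everywhere. -/
theorem diag_eq_zero_or_one_le (hF : IsCoarserNhdsOne F) (hom : OmegaHomogeneous M)
    (ury : IsUrysohn M) {e : M × M → ℝ} (he : MapClusterPt e F distFun)
    (hed : ∀ x y : M, dist x y ≤ e (x, y))
    (hmax : ∀ u, MapClusterPt u F distFun → (∀ x y : M, dist x y ≤ u (x, y)) → u ≤ e) :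
    (∀ x, e (x, x) = 0) ∨ ∀ x y, 1 ≤ e (x, y) := by
  have := ury.nonempty
  have heb := isBiKatetov_of_mapClusterPt ury.dist_le_one he
  have hconj : ∀ (φ : M ≃ᵢ M) x y, e (φ x, φ y) ≤ e (x, y) := fun φ x y =>
    hmax _ (hF.mapClusterPt_conj he φ) (fun x y => by simpa only [φ.dist_eq] using hed (φ x) (φ y)) (x, y)
  have hidem : ∀ x y, bicomp e e (x, y) ≤ e (x, y) := fun x y =>
    hmax _ (hF.mapClusterPt_bicomp hom ury he he)
      (fun x y => (hed x y).trans (le_bicomp heb hed x y)) (x, y)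
  have hsymm : ∀ x y, e (x, y) = e (y, x) := by
    have : ∀ x y, e (x, y) ≤ e (y, x) := fun x y => by
      obtain ⟨φ, h1, h2⟩ := hom.exists_swap x y
      have := hconj φ y x
      rwa [h1, h2] at this
    exact fun x y => (this x y).antisymm (this y x)
  have hdiag : ∀ x y, e (x, x) = e (y, y) := by
    have : ∀ x y, e (x, x) ≤ e (y, y) := fun x y => by
      obtain ⟨φ, h1⟩ := hom.exists_apply_eq y x
      have := hconj φ y y
      rwa [h1] at this
    exact fun x y => (this x y).antisymm (this y x)
  obtain ⟨x₀⟩ := ury.nonempty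
  set c := e (x₀, x₀) with hc
  -- `c = e (x, x) ≤ e (x, y) + dist y x ≤ 2 * e (x, y)`.
  have hhalf : ∀ x y, c / 2 ≤ e (x, y) := fun x y => by
    have h1 := heb.right_lipschitz x x y
    rw [hdiag x x₀, dist_comm] at h1
    linarith [hed x y]
  have hge : ∀ x y r, r ≤ 1 → (∀ w, r ≤ e (x, w) + e (w, y)) → r ≤ e (x, y) :=
    fun x y r hr h => (le_min hr (le_ciInf h)).trans (hidem x y)
  have hcle : ∀ x y, c ≤ e (x, y) := fun x y =>
    hge x y c (heb.le_one _ _) fun w => by linarith [hhalf x w, hhalf w y]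
  have hc0 : 0 ≤ c := heb.nonneg _
  rcases hc0.eq_or_lt with h0 | h0
  · exact Or.inl fun x => (hdiag x x₀).trans h0.symm
  · right
    -- Since `e ≥ c`, idempotence gives `c ≥ min 1 (2 * c)`, impossible for `0 < c < 1`.
    have h1 : 1 ≤ c := by
      by_contra! hlt
      have := hge x₀ x₀ (min 1 (2 * c)) (min_le_left _ _) fun w =>
        (min_le_right _ _).trans (by linarith [hcle x₀ w, hcle w x₀])
      rcases min_le_iff.1 this with h | h <;> linarith
    exact fun x y => h1.trans (hcle x y)

/-- Every member of `F` contains all isometries moving some finite set to distance `1` from itself,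
and every isometry is a quotient of two of these. -/
theorem eq_top_of_one_le (hF : IsCoarserNhdsOne F) (hom : OmegaHomogeneous M) (ury : IsUrysohn M)
    {e : M × M → ℝ} (he : MapClusterPt e F distFun) (h1 : ∀ x y, 1 ≤ e (x, y)) : F = ⊤ := by
  classical
  have key : ∀ V ∈ F, ∃ A : Finset M, ∀ h : M ≃ᵢ M,
      (∀ x ∈ A, ∀ y ∈ A, dist x (h y) = 1) → h ∈ V := by
    intro V hV
    obtain ⟨V', hV', hVV⟩ := hF.exists_mul_mem hV
    obtain ⟨W, hW, hWV⟩ := hF.exists_mul_mem hV'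
    obtain ⟨A₀, hA₀⟩ := hF.exists_finset (inter_mem hV' hW)
    obtain ⟨x₀⟩ := ury.nonempty
    let A := insert x₀ A₀
    have hA : ∀ k : M ≃ᵢ M, (∀ a ∈ A, k a = a) → k ∈ V' ∩ W := fun k hk =>
      hA₀ k fun a ha => hk a (Finset.mem_insert_of_mem ha)
    have hne : Nonempty A := ⟨⟨x₀, Finset.mem_insert_self _ _⟩⟩
    obtain ⟨a, haW, ha⟩ := frequently_iff.1 (mapClusterPt_distFun_iff.1 he A _ one_half_pos) hW
    have ha' : ∀ x ∈ A, ∀ y ∈ A, 1 / 2 ≤ dist x (a y) := fun x hx y hy => by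
      linarith [(abs_lt.1 (ha x hx y hy)).1, h1 x y]
    -- Paths through `A` have length at least `1/2 + 1/2`, so `a * k * a` moves `A` to distance
    -- exactly `1`.
    obtain ⟨k, hkA, hk⟩ := exists_amalgam hom ury A (A.image ⇑a⁻¹) (A.image a)
    have hone : ∀ x ∈ A, ∀ y ∈ A, dist x ((a * k * a) y) = 1 := fun x hx y hy => by
      have h2 := hk _ (Finset.mem_image_of_mem _ hx) _ (Finset.mem_image_of_mem _ hy)
      rw [← a.dist_eq, IsometryEquiv.apply_inv_self] at h2
      refine h2.trans (min_eq_left (le_ciInf fun c => ?_))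
      rw [← a.dist_eq (a⁻¹ x), IsometryEquiv.apply_inv_self]
      linarith [ha' x hx c c.2, ha' c c.2 y hy]
    have hmem := hWV a haW k (hA k hkA).2 a haW
    refine ⟨A, fun h hh => ?_⟩
    -- Any other such `h` lies in the same double coset of the pointwise stabilizer of `A`: `h` is
    -- `l * (a * k * a)` times an element fixing `A`.
    obtain ⟨l, hl⟩ := hom.exists_isometryEquiv
      (Sum.elim (fun x : A => (x : M)) fun x : A => (a * k * a) x)
      (Sum.elim (fun x : A => (x : M)) fun x : A => h x) (by
        rintro (i | i) (j | j)
        · rfl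
        · exact (hone i i.2 j j.2).trans (hh i i.2 j j.2).symm
        · rw [dist_comm, dist_comm (Sum.elim _ _ (Sum.inr i))]
          exact (hone j j.2 i i.2).trans (hh j j.2 i i.2).symm
        · simp only [Sum.elim_inr, IsometryEquiv.dist_eq])
    have hl1 : l ∈ V' := (hA l fun x hx => hl (Sum.inl ⟨x, hx⟩)).1
    have hl2 : (l * (a * k * a))⁻¹ * h ∈ V' := (hA _ fun x hx => by
      rw [IsometryEquiv.mul_apply, ← show (l * (a * k * a)) x = h x from hl (Sum.inr ⟨x, hx⟩),
        IsometryEquiv.inv_apply_self]).1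
    have := hVV l hl1 _ hmem _ hl2
    rwa [mul_inv_cancel_left] at this
  refine eq_top_iff.2 fun U hU => ?_
  rw [mem_top, Set.eq_univ_iff_forall]
  intro g
  obtain ⟨V, hV, hVU⟩ := mem_prod_same_iff.1 (hF.mul hU)
  obtain ⟨A, hA⟩ := key (V ∩ Inv.inv ⁻¹' V) (inter_mem hV (hF.inv hV))
  obtain ⟨k, hk⟩ := exists_dist_eq_one hom ury (A ∪ A.image g)
  have hk1 := hA k fun x hx y hy =>
    hk x (Finset.mem_union_left _ hx) y (Finset.mem_union_left _ hy)
  have hk2 := hA (g⁻¹ * k) fun x hx y hy => by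
    rw [← g.dist_eq, IsometryEquiv.mul_apply, IsometryEquiv.apply_inv_self]
    exact hk _ (Finset.mem_union_right _ (Finset.mem_image_of_mem g hx)) y
      (Finset.mem_union_left _ hy)
  have := hVU (Set.mk_mem_prod hk1.1 hk2.2)
  simpa using this

/-- A group topology on `M ≃ᵢ M` that is coarser than the topology of pointwise convergence is
either indiscrete or has no cluster points at positive distance from `M ≃ᵢ M`. -/
theorem eq_top_or_forall_exists_lt (hF : IsCoarserNhdsOne F) (hom : OmegaHomogeneous M)
    (ury : IsUrysohn M) :
    F = ⊤ ∨ ∀ f, MapClusterPt f F distFun → ∀ x, ∀ ε > 0, ∃ w, f (x, w) < ε := by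
  have := ury.nonempty
  obtain ⟨e, he, hed, hmax⟩ := hF.exists_greatest hom ury
  refine (hF.diag_eq_zero_or_one_le hom ury he hed hmax).symm.imp
    (hF.eq_top_of_one_le hom ury he) fun h0 f hf x ε hε => ?_
  have hfb := isBiKatetov_of_mapClusterPt ury.dist_le_one hf
  -- The composition of `f` with its swap dominates the metric by `left_triangle`, hence lies below
  -- `e`.
  have h1 := hmax _ (hF.mapClusterPt_bicomp hom ury hf (hF.mapClusterPt_swap hf))
    (fun x y => le_min (ury.dist_le_one x y)
      (le_ciInf fun w => by simpa using hfb.left_triangle x y w)) (x, x)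
  rw [h0] at h1
  rcases min_le_iff.1 h1 with h | h
  · linarith
  obtain ⟨w, hw⟩ := exists_lt_of_ciInf_lt (h.trans_lt (mul_pos two_pos hε))
  refine ⟨w, ?_⟩
  simp only [Function.comp, Prod.swap] at hw
  linarith

end IsCoarserNhdsOne

end ClusterPoints

/-! ### Minimality and topological simplicity -/

section Main

variable {M : Type u} [MetricSpace M] {F : Filter (M ≃ᵢ M)} {f : M × M → ℝ}

theorem IsBiKatetov.exists_eq_zero [CompleteSpace M] (hf : IsBiKatetov f) {y : M}
    (h : ∀ ε > 0, ∃ w, f (w, y) < ε) : ∃ z, f (z, y) = 0 := by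
  choose w hw using fun n : ℕ => h (1 / (n + 1)) Nat.one_div_pos_of_nat
  have hlim : Tendsto (fun n : ℕ => (1 / (n + 1) : ℝ)) atTop (𝓝 0) :=
    tendsto_one_div_add_atTop_nhds_zero_nat
  have hc : CauchySeq w := by
    refine cauchySeq_of_le_tendsto_0 (fun n : ℕ => (1 / (n + 1) + 1 / (n + 1) : ℝ))
      (fun n m N hn hm => ?_) (by simpa using hlim.add hlim)
    exact (hf.left_triangle _ _ y).trans (add_le_add
      ((hw n).le.trans (Nat.one_div_le_one_div hn)) ((hw m).le.trans (Nat.one_div_le_one_div hm)))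
  obtain ⟨z, hz⟩ := cauchySeq_tendsto_of_complete hc
  refine ⟨z, le_antisymm ?_ (hf.nonneg _)⟩
  have h1 : Tendsto (fun n : ℕ => dist z (w n) + 1 / ((n : ℝ) + 1)) atTop (𝓝 (0 + 0)) := by
    refine Tendsto.add ?_ hlim
    simpa only [dist_comm z] using tendsto_iff_dist_tendsto_zero.1 hz
  rw [add_zero] at h1
  exact ge_of_tendsto' h1 fun n =>
    (hf.left_lipschitz z (w n) y).trans (add_le_add le_rfl (hw n).le)

/-- Zeros in the columns define `φ`, zeros in the rows define `ψ`. Then `f (x, y)` equals both `dist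
x (φ y)` and `dist (ψ x) y`, which makes them inverse isometries. -/
theorem IsBiKatetov.exists_eq_distFun [CompleteSpace M] (hf : IsBiKatetov f)
    (hl : ∀ y, ∀ ε > 0, ∃ w, f (w, y) < ε) (hr : ∀ x, ∀ ε > 0, ∃ w, f (x, w) < ε) :
    ∃ φ : M ≃ᵢ M, f = distFun φ := by
  choose φ hφ using fun y => hf.exists_eq_zero (hl y)
  choose ψ hψ using fun x => hf.comp_swap.exists_eq_zero (hr x)
  have hfφ : ∀ x y, f (x, y) = dist x (φ y) := fun x y => by
    have h1 := hf.left_lipschitz x (φ y) y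
    have h2 := hf.left_triangle x (φ y) y
    rw [hφ] at h1 h2
    linarith
  have hfψ : ∀ x y, f (x, y) = dist (ψ x) y := fun x y => by
    have h0 : f (x, ψ x) = 0 := hψ x
    have h1 := hf.right_lipschitz x y (ψ x)
    have h2 := hf.right_triangle x y (ψ x)
    rw [h0] at h1 h2
    rw [dist_comm y] at h2
    linarith
  have hadj : ∀ x y, dist x (φ y) = dist (ψ x) y := fun x y => (hfφ x y).symm.trans (hfψ x y)
  have hleft : ∀ y, ψ (φ y) = y := fun y => dist_eq_zero.1 (by rw [← hadj, dist_self])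
  have hright : ∀ x, φ (ψ x) = x := fun x => (dist_eq_zero.1 (by rw [hadj, dist_self])).symm
  exact ⟨⟨⟨φ, ψ, hleft, hright⟩, Isometry.of_dist_eq fun y y' => by
    change dist (φ y) (φ y') = _
    rw [hadj, hleft]⟩, funext fun z => hfφ z.1 z.2⟩

theorem frequently_mem_of_mapClusterPt {φ : M ≃ᵢ M} (h : MapClusterPt (distFun φ) F distFun)
    {U : Set (M ≃ᵢ M)} (hU : U ∈ 𝓝 φ) : ∃ᶠ g in F, g ∈ U := by
  classical
  obtain ⟨P, ε, hε, hP⟩ := mem_nhds_isometryEquiv_iff.1 hU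
  refine (mapClusterPt_distFun_iff.1 h (P ∪ P.image φ) ε hε).mono fun g hg => hP g fun x hx => ?_
  have := hg _ (Finset.mem_union_right _ (Finset.mem_image_of_mem φ hx)) x
    (Finset.mem_union_left _ hx)
  simp only [distFun, dist_self, sub_zero, abs_dist] at this
  rwa [dist_comm]

theorem IsCoarserNhdsOne.le_nhds_one [CompleteSpace M] (hF : IsCoarserNhdsOne F)
    (hom : OmegaHomogeneous M) (ury : IsUrysohn M)
    (hsep : ∀ φ : M ≃ᵢ M, φ ≠ 1 → ∃ U ∈ 𝓝 φ, Uᶜ ∈ F) : F ≤ 𝓝 1 := by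
  rcases hF.eq_top_or_forall_exists_lt hom ury with htop | hlt
  · exfalso
    obtain ⟨x⟩ := ury.nonempty
    obtain ⟨k, hk⟩ := exists_dist_eq_one hom ury {x}
    have hk1 : k ≠ 1 := by
      rintro rfl
      have := hk x (by simp) x (by simp)
      change dist x x = 1 at this
      simp at this
    obtain ⟨U, hU, hUF⟩ := hsep k hk1
    rw [htop, mem_top, Set.compl_univ_iff] at hUF
    exact Set.notMem_empty k (hUF ▸ mem_of_mem_nhds hU)
  · have hlim : Tendsto distFun F (𝓝 (distFun 1)) := by
      refine isCompact_setOf_isBiKatetov.tendsto_nhds_of_unique_mapClusterPt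
        (Eventually.of_forall fun g => isBiKatetov_dist ury.dist_le_one g) fun f hf hcl => ?_
      obtain ⟨φ, rfl⟩ := hf.exists_eq_distFun (hlt _ (hF.mapClusterPt_swap hcl)) (hlt f hcl)
      congr 1
      by_contra hne
      obtain ⟨U, hU, hUF⟩ := hsep φ hne
      obtain ⟨g, hg⟩ := ((frequently_mem_of_mapClusterPt hcl hU).and_eventually hUF).exists
      exact hg.2 hg.1
    intro U hU
    obtain ⟨P, ε, hε, hP⟩ := mem_nhds_isometryEquiv_iff.1 hU
    have h1 : {k : M × M → ℝ | ∀ z ∈ P ×ˢ P, dist (k z) (distFun 1 z) < ε} ∈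
        𝓝 (distFun (1 : M ≃ᵢ M)) := mem_nhds_pi_dist_iff.2 ⟨P ×ˢ P, ε, hε, fun _ => id⟩
    filter_upwards [hlim h1] with g hg
    refine hP g fun x hx => ?_
    have h2 : |dist x (g x) - dist x x| < ε := hg (x, x) (Finset.mk_mem_product hx hx)
    rw [dist_self, sub_zero, abs_dist, dist_comm] at h2
    exact h2

theorem minimalTopologicalGroup_isometryEquiv [CompleteSpace M] (hom : OmegaHomogeneous M)
    (ury : IsUrysohn M) : MinimalTopologicalGroup (M ≃ᵢ M) := by
  refine ⟨inferInstance, inferInstance, fun t' ht hG hT => ?_⟩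
  have hle := (IsCoarserNhdsOne.of_le ht hG).le_nhds_one hom ury fun φ hφ => by
    obtain ⟨u, v, hu, hv, hφu, h1v, huv⟩ := t2_separation hφ
    exact ⟨u, nhds_mono ht (hu.mem_nhds hφu),
      mem_of_superset (hv.mem_nhds h1v) huv.subset_compl_left⟩
  exact IsTopologicalGroup.ext hG isoTopologicalGroup (le_antisymm hle (nhds_mono ht))

theorem topologicallySimple_isometryEquiv (hom : OmegaHomogeneous M)
    (ury : IsUrysohn M) : TopologicallySimple (M ≃ᵢ M) := by
  classical
  intro N hN hclosed
  refine or_iff_not_imp_left.2 fun hbot => ?_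
  obtain ⟨n, hnN, hn1⟩ := N.bot_or_exists_ne_one.resolve_left hbot
  obtain ⟨x₀, hx₀⟩ : ∃ x, n x ≠ x := by
    by_contra! h
    exact hn1 (IsometryEquiv.ext h)
  have hF := IsCoarserNhdsOne.of_le
    (continuous_iff_le_induced.1 (QuotientGroup.continuous_mk (N := N)))
    (topologicalGroup_induced (QuotientGroup.mk' N))
  rw [nhds_induced] at hF
  rcases hF.eq_top_or_forall_exists_lt hom ury with htop | hlt
  · refine (Subgroup.eq_top_iff' N).2 fun g => ?_
    by_contra hg
    have hg' : (QuotientGroup.mk (1 : M ≃ᵢ M) : (M ≃ᵢ M) ⧸ N) ≠ QuotientGroup.mk g := by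
      rw [Ne, QuotientGroup.eq]
      simpa using hg
    have h1 := preimage_mem_comap (m := (QuotientGroup.mk : (M ≃ᵢ M) → (M ≃ᵢ M) ⧸ N))
      (isOpen_compl_singleton.mem_nhds hg')
    have h2 : _ ∈ (⊤ : Filter (M ≃ᵢ M)) := htop ▸ h1
    rw [mem_top] at h2
    exact absurd (h2.ge (Set.mem_univ g)) (by simp)
  · exfalso
    -- Conjugating `n` by a `k` that fixes `x₀` replaces `n x₀` by `k (n x₀)`, placed freely over
    -- `x₀` and so at least `dist x₀ (n x₀)` away from `A`.
    have hconj : ∀ A : Finset M, ∃ m ∈ N, ∀ a ∈ A, dist x₀ (n x₀) ≤ dist a (m x₀) := fun A => by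
      have : Nonempty ({x₀} : Finset M) := ⟨⟨x₀, Finset.mem_singleton_self x₀⟩⟩
      obtain ⟨k, hk, hkA⟩ := exists_amalgam hom ury {x₀} A {n x₀}
      refine ⟨k * n * k⁻¹, hN.conj_mem n hnN k, fun a ha => ?_⟩
      have hk0 : k⁻¹ x₀ = x₀ := by
        conv_lhs => rw [← hk x₀ (Finset.mem_singleton_self _)]
        exact IsometryEquiv.inv_apply_self _ _
      rw [IsometryEquiv.mul_apply, hk0, IsometryEquiv.mul_apply,
        hkA a ha _ (Finset.mem_singleton_self _)]
      refine le_min (ury.dist_le_one _ _) (le_ciInf ?_)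
      rintro ⟨c, hc⟩
      rw [Finset.mem_singleton] at hc
      subst hc
      exact le_add_of_nonneg_left dist_nonneg
    choose m hmN hm using hconj
    obtain ⟨f, -, hf⟩ := isCompact_setOf_isBiKatetov.exists_mapClusterPt
      (f := atTop) (u := fun A => distFun (m A))
      (by
        refine tendsto_principal.2 ?_
        exact Eventually.of_forall fun A => isBiKatetov_dist ury.dist_le_one (m A))
    have hmF : Tendsto m atTop
        (comap (QuotientGroup.mk : (M ≃ᵢ M) → (M ≃ᵢ M) ⧸ N) (𝓝 (QuotientGroup.mk 1))) := by
      refine tendsto_comap_iff.2 (tendsto_const_nhds.congr fun A => ?_)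
      rw [Function.comp, QuotientGroup.eq]
      simpa using hmN A
    have hf' : MapClusterPt f _ distFun := MapClusterPt.of_comp hmF hf
    -- As `A` grows the bound reaches every `w`, so the column of `f` at `x₀` stays at least `dist
    -- x₀ (n x₀)`, against the second alternative.
    obtain ⟨w, hw⟩ := hlt _ (hF.mapClusterPt_swap hf') x₀ _ (dist_pos.2 hx₀.symm)
    have hcl : IsClosed {k : M × M → ℝ | dist x₀ (n x₀) ≤ k (w, x₀)} :=
      isClosed_le continuous_const (continuous_apply _)
    obtain ⟨A, hA, hwA⟩ := ((mapClusterPt_iff_frequently.1 hf _ (hcl.isOpen_compl.mem_nhds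
      (not_le.2 hw))).and_eventually (eventually_ge_atTop {w})).exists
    exact hA (hm A w (hwA (Finset.mem_singleton_self w)))

end Main

end UrysohnIso

theorem theorem1p5 {M : Type u} [MetricSpace M] [CompleteSpace M]
    (homogeneous : UrysohnIso.OmegaHomogeneous M) (urysohn : UrysohnIso.IsUrysohn M) :
    UrysohnIso.RajkovComplete (M ≃ᵢ M) ∧
      UrysohnIso.RoelckePrecompact (M ≃ᵢ M) ∧
      UrysohnIso.MinimalTopologicalGroup (M ≃ᵢ M) ∧
      UrysohnIso.TopologicallySimple (M ≃ᵢ M) ∧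
      UrysohnIso.weight (M ≃ᵢ M) = UrysohnIso.weight M := by
  have := UrysohnIso.infinite_of_isUrysohn homogeneous urysohn
  exact ⟨UrysohnIso.rajkovComplete_isometryEquiv,
    UrysohnIso.roelckePrecompact_isometryEquiv homogeneous urysohn,
    UrysohnIso.minimalTopologicalGroup_isometryEquiv homogeneous urysohn,
    UrysohnIso.topologicallySimple_isometryEquiv homogeneous urysohn,
    le_antisymm UrysohnIso.weight_isometryEquiv_le
      (UrysohnIso.weight_le_weight_isometryEquiv homogeneous)⟩
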